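/- **Model.** Consider a queue with room for at most $l_M$ waiting jobs, arrival rate $\lambda>0$ and two exponential servers with rates $\mu_1\ge\mu_2>0$ (server 1 fast, server 2 slow), uniformized to a discrete-time Markov decision process. A state is $s=(l,b_1,b_2)$ with $0\le l\le l_M$ waiting jobs and $b_i=1$ if server $i$ is busy; its cost is $c(s)=l+b_1+b_2$. Action $a=0$ waits and action $a=i$ routes a waiting job to server $i$ (without effect if server $i$ is busy or $l=0$). After the action the next event is an arrival (lost if the queue is full) or a service event at server 1 or 2 (without effect if the server is idle), with probabilities proportional to $\lambda,\mu_1,\mu_2$. Let $0<\gamma<1$ be the discount factor, $\xi$ the initial distribution, $\Pi$ the set of all stationary randomized policies, $V^\pi(s)=\mathbb E_\pi[\sum_{t\ge0}\gamma^tc(s_t)\mid s_0=s]$, $Q^\pi(s,a)=c(s)+\gamma\sum_{s'}\Pr(s'\mid s,a)V^\pi(s')$, $V^\star=\inf_\pi V^\pi$, $J_\gamma(\pi)=\mathbb E_{s\sim\xi}V^\pi(s)$ and $J_\gamma(\pi^\star)=\inf_{\pi\in\Pi}J_\gamma(\pi)$. Let $T_\pi$ be the Bellman operator of $\pi$ and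 $T$ the Bellman optimality operator. **Policies.** For $\sigma>0$ and $\theta\in\mathbb R$ the soft threshold policy $\pi_\theta$ uses server 1 whenever it is idle and a job waits; in state $(l,1,0)$ it routes a job to server 2 with probability $e^{\sigma(l-\theta)}/(1+e^{\sigma(l-\theta)})$; otherwise it waits. The hard threshold policy with threshold $n\in\mathbb N$ does the same, except that in state $(l,1,0)$ it routes to server 2 if and only if $l>n$. Let $\nu_\theta=(1-\gamma)\sum_{t\ge0}\gamma^t\Pr_{\pi_\theta}(s_t=\cdot\mid s_0\sim\xi)$ and $\mathcal B_\theta(\pi)=\mathbb E_{s\sim\nu_\theta}[(T_{\pi}V^{\pi_\theta})(s)]$. Let $\kappa_\xi$ be the smallest $\kappa\ge0$ with $\|V-V^\star\|_{1,\xi}\le\frac{\kappa}{1-\gamma}\|V-TV\|_{1,\xi}$ for all $V\in\{V^{\pi_\theta}:\theta\in\mathbb R\}$, where $\|V\|_{1,\xi}=\mathbb E_{s\sim\xi}|V(s)|$. Say that $\varepsilon_b\ge0$ is an inherent Bellman error at $\theta$ if $\inf_{\theta^+\in\mathbb R}\mathcal B_\theta(\pi_{\theta^+})\le\inf_{\pi\in\Pi}\mathcal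 B_\theta(\pi)+\varepsilon_b$. **Theorem.** For every $\sigma>0$: 1. $\theta\mapsto J_\gamma(\pi_\theta)$ is continuously differentiable, and so are, for every $\theta$, the maps $\bar\theta\mapsto\mathbb E_{s\sim\nu_\theta}[(T_{\pi_{\bar\theta}}V^{\pi_\theta})(s)]$ and $\bar\theta\mapsto\mathbb E_{s\sim\nu_{\bar\theta}}[(T_{\pi_\theta}V^{\pi_\theta})(s)]$. 2. There is a finite $\varepsilon_b\ge0$ that is an inherent Bellman error at every $\theta$. 3. If for some $n\in\mathbb N$ one has $Q^{\pi_\theta}((l,1,0),0)\le Q^{\pi_\theta}((l,1,0),2)$ for $1\le l\le n$ and $Q^{\pi_\theta}((l,1,0),2)\le Q^{\pi_\theta}((l,1,0),0)$ for $l>n$, then $\bar\theta\mapsto\mathcal B_\theta(\pi_{\bar\theta})$ has no sub-optimal stationary points, that is, each of its stationary points minimizes it over $\mathbb R$. 4. Suppose that $\kappa_\xi$ exists. If $\theta$ is a stationary point of $\theta\mapsto J_\gamma(\pi_\theta)$, if $\bar\theta\mapsto\mathcal B_\theta(\pi_{\bar\theta})$ has no sub-optimal stationary points, and if $\varepsilon_b$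 is an inherent Bellman error at $\theta$, then $$(1-\gamma)\bigl(J_\gamma(\pi_\theta)-J_\gamma(\pi^\star)\bigr)\le\frac{\kappa_\xi}{1-\gamma}\,\varepsilon_b .$$ Moreover, there are $\varepsilon_b(\sigma)\ge0$, depending on $\sigma$ but not on $\theta$, with $\varepsilon_b(\sigma)\to0$ as $\sigma\to\infty$, such that $\varepsilon_b(\sigma)$ is an inherent Bellman error at every $\theta$ for which some hard threshold policy minimizes $\mathcal B_\theta$ over $\Pi$. -/

import Mathlib

open Filter Topology

noncomputable section

namespace TwoServer

/-- A two-server queue with discounted cost: a buffer for at most `cap` jobs, Poisson arrivals of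
rate `arr`, exponential services of rate `fast` (server 1) and `slow` (server 2), and a discount
factor `disc`. -/
structure Queue where
  cap : ℕ
  arr : ℝ
  fast : ℝ
  slow : ℝ
  disc : ℝ
  arr_pos : 0 < arr
  slow_pos : 0 < slow
  slow_le_fast : slow ≤ fast
  disc_pos : 0 < disc
  disc_lt_one : disc < 1

/-- A state `(l, b₁, b₂)`: `l` jobs wait in the queue, and `bᵢ = true` iff server `i` is busy. -/
abbrev State (M : Queue) : Type := Fin (M.cap + 1) × Bool × Bool

/-- Action `0` keeps the jobs in the queue, action `i ∈ {1, 2}` routes a job to server `i`. -/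
abbrev Action : Type := Fin 3

variable (M : Queue)

/-- The cost of a state: the number of jobs in the system. -/
def cost (s : State M) : ℝ :=
  (s.1 : ℕ) + (if s.2.1 then 1 else 0) + (if s.2.2 then 1 else 0)

/-- The state right after the routing decision. Routing to a busy server, or from an empty queue,
has no effect. -/
def dispatch (s : State M) (a : Action) : State M :=
  if a = 1 ∧ 0 < (s.1 : ℕ) ∧ s.2.1 = false then
    (⟨(s.1 : ℕ) - 1, lt_of_le_of_lt (Nat.sub_le _ _) s.1.isLt⟩, true, s.2.2)
  else if a = 2 ∧ 0 < (s.1 : ℕ) ∧ s.2.2 = false then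
    (⟨(s.1 : ℕ) - 1, lt_of_le_of_lt (Nat.sub_le _ _) s.1.isLt⟩, s.2.1, true)
  else s

/-- An arrival; the job is lost if the buffer is full. -/
def arrive (s : State M) : State M :=
  (⟨min ((s.1 : ℕ) + 1) M.cap, Nat.lt_succ_of_le (min_le_right _ _)⟩, s.2)

/-- A service event at server 1; nothing happens if the server is idle. -/
def departFast (s : State M) : State M := (s.1, false, s.2.2)

/-- A service event at server 2; nothing happens if the server is idle. -/
def departSlow (s : State M) : State M := (s.1, s.2.1, false)

/-- The transition probabilities `Pr(s' | s, a)` of the uniformized queue: after the routing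
decision, the next event is an arrival or a service event, with probabilities proportional to the
rates. -/
def trans (s : State M) (a : Action) (s' : State M) : ℝ :=
  (M.arr * (if s' = arrive M (dispatch M s a) then 1 else 0)
    + M.fast * (if s' = departFast M (dispatch M s a) then 1 else 0)
    + M.slow * (if s' = departSlow M (dispatch M s a) then 1 else 0))
    / (M.arr + M.fast + M.slow)

/-- The set of all (stationary, randomized) policies; `prob s a` is the probability of taking
action `a` in state `s`. -/
structure Policy where
  prob : State M → Action → ℝ
  nonneg : ∀ s a, 0 ≤ prob s a
  sum_one : ∀ s, ∑ a, prob s a = 1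

/-- The transition matrix of the Markov chain induced by a policy. -/
def transMatrix (p : Policy M) : Matrix (State M) (State M) ℝ :=
  Matrix.of fun s s' => ∑ a, p.prob s a * trans M s a s'

/-- The value function `V^π(s) = E[∑ₜ γᵗ c(sₜ) | s₀ = s]`; here `E[c(sₜ) | s₀ = s]` is the entry
at `s` of the `t`-th power of the transition matrix applied to the cost vector. -/
def value (p : Policy M) (s : State M) : ℝ :=
  ∑' t : ℕ, M.disc ^ t * ((transMatrix M p ^ t).mulVec (cost M)) s

/-- The discounted cost `J_γ(π) = E_{s ∼ ξ}[V^π(s)]`. -/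
def J (ξ : State M → ℝ) (p : Policy M) : ℝ := ∑ s, ξ s * value M p s

/-- The optimal cost `J_γ(π*) = min_π J_γ(π)`, over all policies. -/
def Jopt (ξ : State M → ℝ) : ℝ := ⨅ p : Policy M, J M ξ p

/-- The optimal value function `V*`. -/
def valueOpt (s : State M) : ℝ := ⨅ p : Policy M, value M p s

/-- The action values of a function `V`: `c(s) + γ ∑ₛ' Pr(s' | s, a) V(s')`. For `V = V^π` this is
`Q^π(s, a)`. -/
def qValue (V : State M → ℝ) (s : State M) (a : Action) : ℝ :=
  cost M s + M.disc * ∑ s', trans M s a s' * V s'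

/-- The Bellman operator `T_π` of a policy. -/
def bellmanPolicy (p : Policy M) (V : State M → ℝ) (s : State M) : ℝ :=
  ∑ a, p.prob s a * qValue M V s a

/-- The Bellman optimality operator `T`. -/
def bellman (V : State M → ℝ) (s : State M) : ℝ := ⨅ a : Action, qValue M V s a

/-- The weighted policy iteration objective `B(π | ν, V) = E_{s ∼ ν}[(T_π V)(s)]`. -/
def B (p : Policy M) (ν V : State M → ℝ) : ℝ := ∑ s, ν s * bellmanPolicy M p V s

/-- The weighted norm `‖V‖_{1,ξ}`. -/
def norm1 (ξ V : State M → ℝ) : ℝ := ∑ s, ξ s * |V s|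

/-- The state distribution `ν_π` induced by a policy in the discounted problem, the probability
distribution `(1 - γ) ∑ₜ γᵗ Pr(sₜ = · | s₀ ∼ ξ)`. It is the stationary distribution of the chain
that follows `π` and that restarts from `ξ` with probability `1 - γ` at each step. -/
def occupancy (ξ : State M → ℝ) (p : Policy M) (s : State M) : ℝ :=
  (1 - M.disc) * ∑' t : ℕ, M.disc ^ t * (Matrix.vecMul ξ (transMatrix M p ^ t)) s

/-- The policy that always uses server 1 if it is idle and a job waits, and that, if server 1 is
busy, server 2 is idle and `l` jobs wait, routes a job to server 2 with probability `r l`. -/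
def fastFirst (r : ℕ → ℝ) (hr : ∀ l, 0 ≤ r l ∧ r l ≤ 1) : Policy M where
  prob s a :=
    if s.2.1 = false then
      if 0 < (s.1 : ℕ) then (if a = 1 then 1 else 0) else (if a = 0 then 1 else 0)
    else if s.2.2 = false then
      (if a = 2 then r s.1 else if a = 0 then 1 - r s.1 else 0)
    else (if a = 0 then 1 else 0)
  nonneg s a := by
    have h1 := (hr s.1).1
    have h2 := (hr s.1).2
    split_ifs <;> linarith
  sum_one s := by
    split_ifs <;> simp [Fin.sum_univ_three]

/-- The soft threshold policy `π_θ` with sharpness `σ`. -/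
def soft (σ θ : ℝ) : Policy M :=
  fastFirst M (fun l => Real.exp (σ * (l - θ)) / (1 + Real.exp (σ * (l - θ)))) (fun l => by
    have h := Real.exp_pos (σ * ((l : ℝ) - θ))
    exact ⟨by positivity, (div_le_one (by positivity)).2 (by linarith)⟩)

/-- The hard threshold policy, which uses server 2 iff more than `n` jobs wait. -/
def hard (n : ℕ) : Policy M :=
  fastFirst M (fun l => if n < l then 1 else 0) (fun l => by split_ifs <;> simp)

/-- The weighted policy iteration objective at the soft threshold policy `π_θ`, that is
`B(π | ν_θ, V^θ)`. -/
def piObjective (σ : ℝ) (ξ : State M → ℝ) (θ : ℝ) (p : Policy M) : ℝ :=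
  B M p (occupancy M ξ (soft M σ θ)) (value M (soft M σ θ))

/-- `κ` is the effective concentrability coefficient of the value functions of the soft threshold
policies: the smallest nonnegative scalar with `‖V - V*‖ ≤ κ / (1 - γ) * ‖V - T V‖` for all of
them. -/
def IsConcentrability (σ : ℝ) (ξ : State M → ℝ) (κ : ℝ) : Prop :=
  IsLeast {k : ℝ | 0 ≤ k ∧ ∀ θ : ℝ,
    norm1 M ξ (fun s => value M (soft M σ θ) s - valueOpt M s) ≤
      k / (1 - M.disc) *
        norm1 M ξ (fun s => value M (soft M σ θ) s - bellman M (value M (soft M σ θ)) s)} κ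

/-- Closure under policy improvement at `π_θ` up to the error `ε`. -/
def ClosedUpTo (σ : ℝ) (ξ : State M → ℝ) (θ ε : ℝ) : Prop :=
  (⨅ x : ℝ, piObjective M σ ξ θ (soft M σ x)) ≤ (⨅ p : Policy M, piObjective M σ ξ θ p) + ε

/-- The weighted policy iteration objective at `π_θ`, as a function of the parameter of a soft
threshold policy, has no sub-optimal stationary points. -/
def NoSuboptimalStationary (σ : ℝ) (ξ : State M → ℝ) (θ : ℝ) : Prop :=
  ∀ x : ℝ, deriv (fun y => piObjective M σ ξ θ (soft M σ y)) x = 0 →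
    ∀ y : ℝ, piObjective M σ ξ θ (soft M σ x) ≤ piObjective M σ ξ θ (soft M σ y)

/-- Some hard threshold policy is a policy improvement of `π_θ` among all policies. -/
def ThresholdImproves (σ : ℝ) (ξ : State M → ℝ) (θ : ℝ) : Prop :=
  ∃ n : ℕ, ∀ p : Policy M, piObjective M σ ξ θ (hard M n) ≤ piObjective M σ ξ θ p

/-- With server 1 busy, server 2 idle and `l ≥ 1` waiting jobs, the action values of `π_θ` prefer
waiting for `l ≤ n` and prefer routing to server 2 for `l > n`, for some `n`. -/
def SingleCrossing (σ : ℝ) (θ : ℝ) : Prop :=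
  ∃ n : ℕ, ∀ l : Fin (M.cap + 1), 1 ≤ (l : ℕ) →
    ((l : ℕ) ≤ n → qValue M (value M (soft M σ θ)) (l, true, false) 0 ≤
      qValue M (value M (soft M σ θ)) (l, true, false) 2) ∧
    (n < (l : ℕ) → qValue M (value M (soft M σ θ)) (l, true, false) 2 ≤
      qValue M (value M (soft M σ θ)) (l, true, false) 0)

end TwoServer

end

/-!
The potential matrix `U = ∑ₜ γᵗ Pᵗ = (1 - γ P)⁻¹` inherits the smoothness of the transition matrix
`P` in the policy parameter, and both the value function `U c` and the occupancy `(1 - γ) ξ U` are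
linear in it. By the performance difference identity
`⟨ν_π, T_π V - V⟩ = (1 - γ) (J(π) - ⟨ξ, V⟩)`, differentiated at `π = π_θ` with `V = V^{π_θ}`, the
threshold `θ` is stationary for the cost `J` iff it is stationary for the improvement objective
`B_θ`. If `θ` minimizes `B_θ` over the soft thresholds, its Bellman residual is at most `ε_b` in
`ν_θ`-mean, and `ν_θ ≥ (1 - γ) ξ` turns this into a bound on `(1 - γ) ‖V - T V‖_{1,ξ}`, to which the
concentrability coefficient applies.

As a function of the soft threshold `x`, the objective `B_θ` is, up to a constant, a mixture
`∑ₗ w_l sigmoid(σ (l - x))` whose weights `w_l` are advantages of routing to the slow server. Single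
crossing says that `w` changes sign once, from nonnegative to nonpositive. The logistic density
`1 / (4 cosh² (x / 2))` is log-concave, hence totally positive of order two as a location kernel,
so the derivative of the mixture changes sign at most once, from nonpositive to nonnegative.

The soft threshold `n + 1 / 2` routes with probabilities within `exp (-σ / 2)` of those of the hard
threshold `n`, since every queue length is at distance at least `1 / 2` from `n + 1 / 2`.
-/

noncomputable section

open scoped Matrix

/-- The mixture `x ↦ ∑ i, w i * sigmoid (σ * (a i - x))` of reflected logistic curves with
locations `a`, signed weights `w` and common sharpness `σ`. As a function of the threshold, the
policy improvement objective is of this form up to a constant. -/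
def sigmoidMixture {ι : Type*} [Fintype ι] (σ : ℝ) (w a : ι → ℝ) (x : ℝ) : ℝ :=
  ∑ i, w i * Real.sigmoid (σ * (a i - x))

/-- The `γ`-potential matrix `∑ₜ γᵗ Pᵗ` of a Markov chain with transition matrix `P`. -/
def potentialMatrix {n : Type*} [Fintype n] [DecidableEq n] (γ : ℝ) (P : Matrix n n ℝ) :
    Matrix n n ℝ :=
  ∑' t : ℕ, γ ^ t • P ^ t

section Sigmoid

lemma exp_div_one_add_exp (x : ℝ) : Real.exp x / (1 + Real.exp x) = Real.sigmoid x := by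
  rw [Real.sigmoid_def, Real.exp_neg]
  field_simp
  ring

lemma abs_sigmoid_sub_ite_le (x : ℝ) :
    |Real.sigmoid x - if 0 < x then 1 else 0| ≤ Real.exp (-|x|) := by
  have sigmoid_neg_le (y : ℝ) : Real.sigmoid (-y) ≤ Real.exp (-y) := by
    rw [← Real.sigmoid_mul_rexp_neg]
    exact mul_le_of_le_one_left (Real.exp_pos _).le (Real.sigmoid_le_one y)
  split_ifs with hx
  · rw [abs_sub_comm, ← Real.sigmoid_neg, abs_of_pos (Real.sigmoid_pos _), abs_of_pos hx]
    exact sigmoid_neg_le x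
  · rw [sub_zero, abs_of_pos (Real.sigmoid_pos _), abs_of_nonpos (not_lt.1 hx), neg_neg]
    simpa only [neg_neg] using sigmoid_neg_le (-x)

lemma deriv_sigmoid_eq_inv_cosh_sq (x : ℝ) :
    deriv Real.sigmoid x = (4 * Real.cosh (x / 2) ^ 2)⁻¹ := by
  have hx : Real.exp (-x) = (Real.exp (x / 2) ^ 2)⁻¹ := by
    rw [← Real.exp_nat_mul, ← Real.exp_neg]
    push_cast
    ring_nf
  simp only [Real.deriv_sigmoid, Real.sigmoid_def, Real.cosh_eq, hx, Real.exp_neg (x / 2)]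
  field_simp
  ring

lemma deriv_sigmoid_pos (x : ℝ) : 0 < deriv Real.sigmoid x := by
  rw [deriv_sigmoid_eq_inv_cosh_sq]
  positivity [Real.cosh_pos (x / 2)]

lemma cosh_mul_cosh_le {p q r s : ℝ} (hsum : p + q = r + s) (hpr : p ≤ r) (hps : p ≤ s) :
    Real.cosh r * Real.cosh s ≤ Real.cosh p * Real.cosh q := by
  have two_mul_cosh_mul_cosh (u v : ℝ) :
      2 * (Real.cosh u * Real.cosh v) = Real.cosh (u + v) + Real.cosh (u - v) := by
    rw [Real.cosh_add, Real.cosh_sub]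
    ring
  have hdiff : Real.cosh (r - s) ≤ Real.cosh (p - q) := by
    rw [Real.cosh_le_cosh, abs_sub_comm p q, le_abs]
    exact Or.inl (abs_le.2 ⟨by linarith, by linarith⟩)
  linarith [two_mul_cosh_mul_cosh r s, two_mul_cosh_mul_cosh p q, congrArg Real.cosh hsum]

lemma deriv_sigmoid_mul_le {p q r s : ℝ} (hsum : p + q = r + s) (hpr : p ≤ r) (hps : p ≤ s) :
    deriv Real.sigmoid p * deriv Real.sigmoid q ≤ deriv Real.sigmoid r * deriv Real.sigmoid s := by
  have hcosh := cosh_mul_cosh_le (p := p / 2) (q := q / 2) (r := r / 2) (s := s / 2)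
    (by linarith) (by linarith) (by linarith)
  have hcosh_nonneg : 0 ≤ Real.cosh (r / 2) * Real.cosh (s / 2) := by
    positivity [Real.cosh_pos (r / 2), Real.cosh_pos (s / 2)]
  simp only [deriv_sigmoid_eq_inv_cosh_sq, ← mul_inv, mul_mul_mul_comm (4 : ℝ), ← mul_pow]
  refine inv_anti₀ (by positivity [Real.cosh_pos (r / 2), Real.cosh_pos (s / 2)]) ?_
  exact mul_le_mul_of_nonneg_left (pow_le_pow_left₀ hcosh_nonneg hcosh 2) (by norm_num)

variable {ι : Type*} [Fintype ι] {σ c : ℝ} {w a : ι → ℝ}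

lemma hasDerivAt_sigmoidMixture (σ : ℝ) (w a : ι → ℝ) (x : ℝ) :
    HasDerivAt (sigmoidMixture σ w a)
      (∑ i, -σ * (w i * deriv Real.sigmoid (σ * (a i - x)))) x := by
  refine HasDerivAt.fun_sum fun i _ => ?_
  have harg : HasDerivAt (fun y => σ * (a i - y)) (σ * -1) x :=
    ((hasDerivAt_id x).const_sub (a i)).const_mul σ
  exact ((differentiableAt_sigmoid.hasDerivAt.comp x harg).const_mul (w i)).congr_deriv (by ring)

/-- Total positivity of the logistic location family makes each summand of the ratio monotone. -/
lemma monotone_deriv_sigmoidMixture_div (hσ : 0 ≤ σ) (hpos : ∀ i, a i ≤ c → 0 ≤ w i)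
    (hneg : ∀ i, c < a i → w i ≤ 0) :
    Monotone fun x => deriv (sigmoidMixture σ w a) x / deriv Real.sigmoid (σ * (c - x)) := by
  intro x y hxy
  have mul_deriv_sigmoid_le {l m : ℝ} (hlm : l ≤ m) :
      deriv Real.sigmoid (σ * (l - y)) * deriv Real.sigmoid (σ * (m - x)) ≤
        deriv Real.sigmoid (σ * (l - x)) * deriv Real.sigmoid (σ * (m - y)) :=
    deriv_sigmoid_mul_le (by ring) (by gcongr) (by gcongr)
  simp only [(hasDerivAt_sigmoidMixture σ w a _).deriv, Finset.sum_div, mul_div_assoc]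
  refine Finset.sum_le_sum fun i _ => mul_le_mul_of_nonpos_left ?_ (neg_nonpos.2 hσ)
  rcases le_or_gt (a i) c with hi | hi
  · refine mul_le_mul_of_nonneg_left ?_ (hpos i hi)
    rw [div_le_div_iff₀ (deriv_sigmoid_pos _) (deriv_sigmoid_pos _)]
    exact mul_deriv_sigmoid_le hi
  · refine mul_le_mul_of_nonpos_left ?_ (hneg i hi)
    rw [div_le_div_iff₀ (deriv_sigmoid_pos _) (deriv_sigmoid_pos _), mul_comm,
      mul_comm (deriv _ (σ * (a i - y)))]
    exact mul_deriv_sigmoid_le hi.le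

lemma sigmoidMixture_le_of_deriv_eq_zero (hσ : 0 ≤ σ) (hpos : ∀ i, a i ≤ c → 0 ≤ w i)
    (hneg : ∀ i, c < a i → w i ≤ 0) {x : ℝ} (hx : deriv (sigmoidMixture σ w a) x = 0) (y : ℝ) :
    sigmoidMixture σ w a x ≤ sigmoidMixture σ w a y := by
  have hdiff : Differentiable ℝ (sigmoidMixture σ w a) := fun z =>
    (hasDerivAt_sigmoidMixture σ w a z).differentiableAt
  have hmono := monotone_deriv_sigmoidMixture_div hσ hpos hneg
  have hleft : ∀ z ∈ Set.Iio x, deriv (sigmoidMixture σ w a) z ≤ 0 := fun z hz => by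
    have hratio := hmono (Set.mem_Iio.1 hz).le
    simp only [hx, zero_div] at hratio
    simpa only [zero_mul] using (div_le_iff₀ (deriv_sigmoid_pos _)).1 hratio
  have hright : ∀ z ∈ Set.Ioi x, 0 ≤ deriv (sigmoidMixture σ w a) z := fun z hz => by
    have hratio := hmono (Set.mem_Ioi.1 hz).le
    simp only [hx, zero_div] at hratio
    simpa only [zero_mul] using (le_div_iff₀ (deriv_sigmoid_pos _)).1 hratio
  exact isMinOn_univ_of_deriv hdiff.continuous.continuousAt hdiff.differentiableOn
    hdiff.differentiableOn hleft hright (Set.mem_univ y)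

end Sigmoid

section PotentialMatrix

variable {n : Type*} [Fintype n]

lemma sum_mul_mem_Icc_of_mem_stdSimplex {w f : n → ℝ} {a b : ℝ} (hw : w ∈ stdSimplex ℝ n)
    (hf : ∀ i, f i ∈ Set.Icc a b) : ∑ i, w i * f i ∈ Set.Icc a b :=
  (convex_Icc a b).sum_mem (fun i _ => hw.1 i) hw.2 fun i _ => hf i

variable [DecidableEq n] {γ : ℝ} {P : Matrix n n ℝ}

attribute [local instance] Matrix.linftyOpNormedRing Matrix.linftyOpNormedAlgebra

lemma linfty_opNorm_smul_lt_one (hγ : |γ| < 1) (hP : P ∈ Matrix.rowStochastic ℝ n) :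
    ‖γ • P‖ < 1 := by
  have hnorm : ‖P‖₊ ≤ 1 := by
    rw [Matrix.linfty_opNNNorm_def]
    refine Finset.sup_le fun i _ => NNReal.coe_le_coe.1 ?_
    push_cast
    simp only [Real.norm_of_nonneg (Matrix.nonneg_of_mem_rowStochastic hP),
      Matrix.sum_row_of_mem_rowStochastic hP, le_refl]
  rw [norm_smul]
  exact mul_lt_one_of_nonneg_of_lt_one_left (norm_nonneg γ) hγ hnorm

lemma hasSum_potentialMatrix (hγ : |γ| < 1) (hP : P ∈ Matrix.rowStochastic ℝ n) :
    HasSum (fun t : ℕ => γ ^ t • P ^ t) (potentialMatrix γ P) := by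
  have hsum := summable_geometric_of_norm_lt_one (linfty_opNorm_smul_lt_one hγ hP)
  simp only [smul_pow] at hsum
  exact hsum.hasSum

lemma potentialMatrix_mul_one_sub (hγ : |γ| < 1) (hP : P ∈ Matrix.rowStochastic ℝ n) :
    potentialMatrix γ P * (1 - γ • P) = 1 := by
  have hgeom := geom_series_mul_neg _ (linfty_opNorm_smul_lt_one hγ hP)
  simp only [smul_pow] at hgeom
  exact hgeom

lemma one_sub_mul_potentialMatrix (hγ : |γ| < 1) (hP : P ∈ Matrix.rowStochastic ℝ n) :
    (1 - γ • P) * potentialMatrix γ P = 1 := by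
  have hgeom := mul_neg_geom_series _ (linfty_opNorm_smul_lt_one hγ hP)
  simp only [smul_pow] at hgeom
  exact hgeom

lemma hasSum_potentialMatrix_apply (hγ : |γ| < 1) (hP : P ∈ Matrix.rowStochastic ℝ n) (i j : n) :
    HasSum (fun t : ℕ => γ ^ t * (P ^ t) i j) (potentialMatrix γ P i j) :=
  Pi.hasSum.1 (Pi.hasSum.1 (hasSum_potentialMatrix hγ hP) i) j

lemma hasSum_potentialMatrix_mulVec (hγ : |γ| < 1) (hP : P ∈ Matrix.rowStochastic ℝ n)
    (v : n → ℝ) (i : n) :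
    HasSum (fun t : ℕ => γ ^ t * (P ^ t *ᵥ v) i) ((potentialMatrix γ P *ᵥ v) i) := by
  simp only [Matrix.mulVec, dotProduct, Finset.mul_sum, ← mul_assoc]
  exact hasSum_sum fun j _ => (hasSum_potentialMatrix_apply hγ hP i j).mul_right (v j)

lemma hasSum_vecMul_potentialMatrix (hγ : |γ| < 1) (hP : P ∈ Matrix.rowStochastic ℝ n)
    (v : n → ℝ) (j : n) :
    HasSum (fun t : ℕ => γ ^ t * (v ᵥ* P ^ t) j) ((v ᵥ* potentialMatrix γ P) j) := by
  simp only [Matrix.vecMul, dotProduct, Finset.mul_sum, mul_left_comm _ (v _)]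
  exact hasSum_sum fun i _ => (hasSum_potentialMatrix_apply hγ hP i j).mul_left (v i)

lemma one_apply_le_potentialMatrix_apply (hγ₀ : 0 ≤ γ) (hγ₁ : γ < 1)
    (hP : P ∈ Matrix.rowStochastic ℝ n) (i j : n) :
    (1 : Matrix n n ℝ) i j ≤ potentialMatrix γ P i j := by
  have hγ : |γ| < 1 := by rwa [abs_of_nonneg hγ₀]
  have hpow (t : ℕ) : 0 ≤ γ ^ t * (P ^ t) i j :=
    mul_nonneg (pow_nonneg hγ₀ t) (Matrix.nonneg_of_mem_rowStochastic (pow_mem hP t))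
  simpa only [pow_zero, one_mul] using
    le_hasSum (hasSum_potentialMatrix_apply hγ hP i j) 0 fun t _ => hpow t

lemma smul_potentialMatrix_mem_rowStochastic (hγ₀ : 0 ≤ γ) (hγ₁ : γ < 1)
    (hP : P ∈ Matrix.rowStochastic ℝ n) :
    (1 - γ) • potentialMatrix γ P ∈ Matrix.rowStochastic ℝ n := by
  have hγ : |γ| < 1 := by rwa [abs_of_nonneg hγ₀]
  refine Matrix.mem_rowStochastic.2 ⟨fun i j => mul_nonneg (sub_nonneg.2 hγ₁.le) ?_, ?_⟩
  · refine le_trans ?_ (one_apply_le_potentialMatrix_apply hγ₀ hγ₁ hP i j)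
    exact Matrix.nonneg_of_mem_rowStochastic (one_mem _)
  · have hone : (1 - γ • P) *ᵥ 1 = (1 - γ) • 1 := by
      rw [Matrix.sub_mulVec, Matrix.one_mulVec, Matrix.smul_mulVec, hP.2, sub_smul, one_smul]
    rw [Matrix.smul_mulVec, ← Matrix.mulVec_smul, ← hone, Matrix.mulVec_mulVec,
      potentialMatrix_mul_one_sub hγ hP, Matrix.one_mulVec]

lemma row_mem_stdSimplex (hP : P ∈ Matrix.rowStochastic ℝ n) (i : n) :
    P i ∈ stdSimplex ℝ n :=
  ⟨fun _ => Matrix.nonneg_of_mem_rowStochastic hP, Matrix.sum_row_of_mem_rowStochastic hP i⟩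

lemma vecMul_mem_stdSimplex {v : n → ℝ} (hv : v ∈ stdSimplex ℝ n)
    (hP : P ∈ Matrix.rowStochastic ℝ n) : v ᵥ* P ∈ stdSimplex ℝ n := by
  refine ⟨Matrix.nonneg_vecMul_of_mem_rowStochastic hP hv.1, ?_⟩
  simpa only [dotProduct_one] using Matrix.vecMul_dotProduct_one_eq_one_rowStochastic hP
    (by simpa only [dotProduct_one] using hv.2)

lemma potentialMatrix_mulVec_mem_Icc (hγ₀ : 0 ≤ γ) (hγ₁ : γ < 1)
    (hP : P ∈ Matrix.rowStochastic ℝ n) {c : n → ℝ} {a b : ℝ} (hc : ∀ i, c i ∈ Set.Icc a b)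
    (i : n) : (potentialMatrix γ P *ᵥ c) i ∈ Set.Icc (a / (1 - γ)) (b / (1 - γ)) := by
  have hγ : 0 < 1 - γ := sub_pos.2 hγ₁
  have hmean : (1 - γ) * (potentialMatrix γ P *ᵥ c) i ∈ Set.Icc a b := by
    rw [← smul_eq_mul, ← Pi.smul_apply, ← Matrix.smul_mulVec]
    exact sum_mul_mem_Icc_of_mem_stdSimplex (row_mem_stdSimplex
      (smul_potentialMatrix_mem_rowStochastic hγ₀ hγ₁ hP) i) hc
  exact ⟨(div_le_iff₀' hγ).2 hmean.1, (le_div_iff₀' hγ).2 hmean.2⟩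

lemma contDiff_potentialMatrix_apply {E : Type*} [NormedAddCommGroup E] [NormedSpace ℝ E]
    {k : WithTop ℕ∞} {P : E → Matrix n n ℝ} (hγ : |γ| < 1)
    (hP : ∀ x, P x ∈ Matrix.rowStochastic ℝ n) (hsmooth : ∀ i j, ContDiff ℝ k fun x => P x i j)
    (i j : n) : ContDiff ℝ k fun x => potentialMatrix γ (P x) i j := by
  let ofEntries : (n → n → ℝ) →L[ℝ] Matrix n n ℝ :=
    LinearMap.toContinuousLinearMap (Matrix.ofLinearEquiv ℝ).toLinearMap
  let entry : Matrix n n ℝ →L[ℝ] ℝ :=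
    LinearMap.toContinuousLinearMap (Matrix.entryLinearMap ℝ ℝ i j)
  have hmatrix : ContDiff ℝ k fun x => 1 - γ • P x :=
    contDiff_const.sub ((ofEntries.contDiff.comp
      (contDiff_pi.2 fun i => contDiff_pi.2 (hsmooth i))).const_smul γ)
  let unit (x : E) : (Matrix n n ℝ)ˣ := ⟨1 - γ • P x, potentialMatrix γ (P x),
    one_sub_mul_potentialMatrix hγ (hP x), potentialMatrix_mul_one_sub hγ (hP x)⟩
  have hinverse (x : E) : Ring.inverse (1 - γ • P x) = potentialMatrix γ (P x) :=
    Ring.inverse_unit (unit x)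
  have hpotential : ContDiff ℝ k fun x => potentialMatrix γ (P x) := by
    simp only [← hinverse]
    exact contDiff_iff_contDiffAt.2 fun x =>
      ContDiffAt.comp (g := Ring.inverse) x (contDiffAt_ringInverse ℝ (unit x))
        hmatrix.contDiffAt
  exact entry.contDiff.comp hpotential

end PotentialMatrix

namespace TwoServer

variable {M : Queue}

lemma one_sub_disc_pos : 0 < 1 - M.disc := sub_pos.2 M.disc_lt_one

lemma abs_disc_lt_one : |M.disc| < 1 := by
  rw [abs_of_pos M.disc_pos]
  exact M.disc_lt_one

lemma trans_mem_stdSimplex (s : State M) (a : Action) : trans M s a ∈ stdSimplex ℝ (State M) := by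
  have harr := M.arr_pos
  have hslow := M.slow_pos
  have hfast := hslow.trans_le M.slow_le_fast
  refine ⟨fun s' => by unfold trans; positivity, ?_⟩
  simp only [trans, ← Finset.sum_div, Finset.sum_add_distrib, mul_ite, mul_one, mul_zero,
    Finset.sum_ite_eq', Finset.mem_univ, if_true]
  exact div_self (by positivity)

lemma Policy.prob_mem_stdSimplex (p : Policy M) (s : State M) : p.prob s ∈ stdSimplex ℝ Action :=
  ⟨p.nonneg s, p.sum_one s⟩

lemma transMatrix_mem_rowStochastic (p : Policy M) :
    transMatrix M p ∈ Matrix.rowStochastic ℝ (State M) := by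
  have hrow (s : State M) : transMatrix M p s ∈ stdSimplex ℝ (State M) := by
    convert (convex_stdSimplex ℝ (State M)).sum_mem (fun a _ => p.nonneg s a) (p.sum_one s)
      fun a _ => trans_mem_stdSimplex s a
    ext s'
    simp only [transMatrix, Matrix.of_apply, Finset.sum_apply, Pi.smul_apply, smul_eq_mul]
  exact Matrix.mem_rowStochastic_iff_sum.2 ⟨fun s => (hrow s).1, fun s => (hrow s).2⟩

lemma value_eq_potentialMatrix_mulVec (p : Policy M) :
    value M p = potentialMatrix M.disc (transMatrix M p) *ᵥ cost M :=
  funext fun s => (hasSum_potentialMatrix_mulVec abs_disc_lt_one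
    (transMatrix_mem_rowStochastic p) (cost M) s).tsum_eq

lemma occupancy_eq_vecMul_potentialMatrix (ξ : State M → ℝ) (p : Policy M) :
    occupancy M ξ p = ξ ᵥ* ((1 - M.disc) • potentialMatrix M.disc (transMatrix M p)) := by
  rw [Matrix.vecMul_smul]
  exact funext fun s => congrArg ((1 - M.disc) * ·) (hasSum_vecMul_potentialMatrix abs_disc_lt_one
    (transMatrix_mem_rowStochastic p) ξ s).tsum_eq

lemma smul_potentialMatrix_transMatrix_mem_rowStochastic (p : Policy M) :
    (1 - M.disc) • potentialMatrix M.disc (transMatrix M p) ∈ Matrix.rowStochastic ℝ (State M) :=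
  smul_potentialMatrix_mem_rowStochastic M.disc_pos.le M.disc_lt_one
    (transMatrix_mem_rowStochastic p)

variable {ξ : State M → ℝ}

lemma occupancy_nonneg (hξ : ∀ s, 0 ≤ ξ s) (p : Policy M) (s : State M) :
    0 ≤ occupancy M ξ p s := by
  rw [occupancy_eq_vecMul_potentialMatrix]
  exact Matrix.nonneg_vecMul_of_mem_rowStochastic
    (smul_potentialMatrix_transMatrix_mem_rowStochastic p) hξ s

lemma occupancy_mem_stdSimplex (hξ : ξ ∈ stdSimplex ℝ (State M)) (p : Policy M) :
    occupancy M ξ p ∈ stdSimplex ℝ (State M) := by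
  rw [occupancy_eq_vecMul_potentialMatrix]
  exact vecMul_mem_stdSimplex hξ (smul_potentialMatrix_transMatrix_mem_rowStochastic p)

lemma one_sub_disc_mul_le_occupancy (hξ : ∀ s, 0 ≤ ξ s) (p : Policy M) (s : State M) :
    (1 - M.disc) * ξ s ≤ occupancy M ξ p s := by
  rw [occupancy_eq_vecMul_potentialMatrix, Matrix.vecMul_smul]
  refine mul_le_mul_of_nonneg_left ?_ one_sub_disc_pos.le
  calc ξ s = (ξ ᵥ* 1) s := by rw [Matrix.vecMul_one]
    _ ≤ (ξ ᵥ* potentialMatrix M.disc (transMatrix M p)) s :=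
      Finset.sum_le_sum fun s' _ => mul_le_mul_of_nonneg_left
        (one_apply_le_potentialMatrix_apply M.disc_pos.le M.disc_lt_one
          (transMatrix_mem_rowStochastic p) s' s) (hξ s')

lemma bellmanPolicy_eq (p : Policy M) (V : State M → ℝ) :
    bellmanPolicy M p V = cost M + M.disc • transMatrix M p *ᵥ V := by
  funext s
  have hcost : ∑ a, p.prob s a * cost M s = cost M s := by rw [← Finset.sum_mul, p.sum_one, one_mul]
  simp only [bellmanPolicy, qValue, mul_add, Finset.sum_add_distrib, hcost, Pi.add_apply,
    Pi.smul_apply, smul_eq_mul, Matrix.mulVec, dotProduct, transMatrix, Matrix.of_apply,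
    Finset.sum_mul, Finset.mul_sum, add_right_inj]
  rw [Finset.sum_comm]
  exact Finset.sum_congr rfl fun _ _ => Finset.sum_congr rfl fun _ _ => by ring

lemma bellmanPolicy_sub (p : Policy M) (V : State M → ℝ) :
    bellmanPolicy M p V - V = cost M - (1 - M.disc • transMatrix M p) *ᵥ V := by
  rw [bellmanPolicy_eq, Matrix.sub_mulVec, Matrix.one_mulVec, Matrix.smul_mulVec]
  abel

lemma bellmanPolicy_value (p : Policy M) : bellmanPolicy M p (value M p) = value M p := by
  rw [← sub_eq_zero, bellmanPolicy_sub, value_eq_potentialMatrix_mulVec, Matrix.mulVec_mulVec,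
    one_sub_mul_potentialMatrix abs_disc_lt_one (transMatrix_mem_rowStochastic p),
    Matrix.one_mulVec, sub_self]

lemma performance_difference (ξ V : State M → ℝ) (p : Policy M) :
    ∑ s, occupancy M ξ p s * (bellmanPolicy M p V s - V s) =
      (1 - M.disc) * (J M ξ p - ∑ s, ξ s * V s) := by
  change occupancy M ξ p ⬝ᵥ (bellmanPolicy M p V - V) =
    (1 - M.disc) * (ξ ⬝ᵥ value M p - ξ ⬝ᵥ V)
  rw [bellmanPolicy_sub, occupancy_eq_vecMul_potentialMatrix, Matrix.vecMul_smul, smul_dotProduct,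
    smul_eq_mul, ← Matrix.dotProduct_mulVec, Matrix.mulVec_sub, Matrix.mulVec_mulVec,
    potentialMatrix_mul_one_sub abs_disc_lt_one (transMatrix_mem_rowStochastic p),
    Matrix.one_mulVec, ← value_eq_potentialMatrix_mulVec, dotProduct_sub]

section Bounds

variable (M) in
/-- The discounted cost of a system that is always full, an upper bound for every value function. -/
def valueBound : ℝ := (M.cap + 2) / (1 - M.disc)

variable (M) in
lemma valueBound_nonneg : 0 ≤ valueBound M := div_nonneg (by positivity) one_sub_disc_pos.le

lemma cost_mem_Icc (s : State M) : cost M s ∈ Set.Icc (0 : ℝ) (M.cap + 2) := by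
  have hcap : ((s.1 : ℕ) : ℝ) ≤ M.cap := by exact_mod_cast Nat.le_of_lt_succ s.1.isLt
  unfold cost
  refine ⟨by positivity, ?_⟩
  split_ifs <;> linarith

lemma value_mem_Icc (p : Policy M) (s : State M) : value M p s ∈ Set.Icc 0 (valueBound M) := by
  rw [value_eq_potentialMatrix_mulVec, ← zero_div (1 - M.disc)]
  exact potentialMatrix_mulVec_mem_Icc M.disc_pos.le M.disc_lt_one
    (transMatrix_mem_rowStochastic p) cost_mem_Icc s

lemma qValue_mem_Icc {V : State M → ℝ} (hV : ∀ s, V s ∈ Set.Icc 0 (valueBound M)) (s : State M)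
    (a : Action) : qValue M V s a ∈ Set.Icc 0 (valueBound M) := by
  have hcost := cost_mem_Icc s
  have hnext := sum_mul_mem_Icc_of_mem_stdSimplex (trans_mem_stdSimplex s a) hV
  have hbound : M.cap + 2 + M.disc * valueBound M = valueBound M := by
    have hdisc : 1 - M.disc ≠ 0 := one_sub_disc_pos.ne'
    unfold valueBound
    field_simp
    ring
  exact ⟨add_nonneg hcost.1 (mul_nonneg M.disc_pos.le hnext.1),
    (add_le_add hcost.2 (mul_le_mul_of_nonneg_left hnext.2 M.disc_pos.le)).trans_eq hbound⟩

lemma B_mem_Icc {ν V : State M → ℝ} {a b : ℝ} (hν : ν ∈ stdSimplex ℝ (State M))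
    (hV : ∀ s i, qValue M V s i ∈ Set.Icc a b) (p : Policy M) : B M p ν V ∈ Set.Icc a b :=
  sum_mul_mem_Icc_of_mem_stdSimplex hν fun s =>
    sum_mul_mem_Icc_of_mem_stdSimplex (p.prob_mem_stdSimplex s) (hV s)

lemma piObjective_mem_Icc (hξ : ξ ∈ stdSimplex ℝ (State M)) (σ θ : ℝ) (p : Policy M) :
    piObjective M σ ξ θ p ∈ Set.Icc 0 (valueBound M) :=
  B_mem_Icc (occupancy_mem_stdSimplex hξ _) (qValue_mem_Icc (value_mem_Icc _)) p

end Bounds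

section Smoothness

variable {E : Type*} [NormedAddCommGroup E] [NormedSpace ℝ E] {k : WithTop ℕ∞} {p : E → Policy M}

lemma contDiff_potentialMatrix_transMatrix_apply
    (hp : ∀ s a, ContDiff ℝ k fun x => (p x).prob s a) (s s' : State M) :
    ContDiff ℝ k fun x => potentialMatrix M.disc (transMatrix M (p x)) s s' := by
  refine contDiff_potentialMatrix_apply abs_disc_lt_one
    (fun x => transMatrix_mem_rowStochastic (p x)) (fun s s' => ?_) s s'
  simp only [transMatrix, Matrix.of_apply]
  exact ContDiff.sum fun a _ => (hp s a).mul contDiff_const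

lemma contDiff_J (hp : ∀ s a, ContDiff ℝ k fun x => (p x).prob s a) (ξ : State M → ℝ) :
    ContDiff ℝ k fun x => J M ξ (p x) := by
  simp only [J, value_eq_potentialMatrix_mulVec]
  exact ContDiff.sum fun s _ => contDiff_const.mul <| ContDiff.sum fun s' _ =>
    (contDiff_potentialMatrix_transMatrix_apply hp s s').mul contDiff_const

lemma contDiff_occupancy (hp : ∀ s a, ContDiff ℝ k fun x => (p x).prob s a) (ξ : State M → ℝ)
    (s : State M) : ContDiff ℝ k fun x => occupancy M ξ (p x) s := by
  simp only [occupancy_eq_vecMul_potentialMatrix]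
  exact ContDiff.sum fun s' _ => contDiff_const.mul <| contDiff_const.mul <|
    contDiff_potentialMatrix_transMatrix_apply hp s' s

lemma contDiff_bellmanPolicy (hp : ∀ s a, ContDiff ℝ k fun x => (p x).prob s a)
    (V : State M → ℝ) (s : State M) : ContDiff ℝ k fun x => bellmanPolicy M (p x) V s :=
  ContDiff.sum fun a _ => (hp s a).mul contDiff_const

lemma contDiff_B (hp : ∀ s a, ContDiff ℝ k fun x => (p x).prob s a) (ν V : State M → ℝ) :
    ContDiff ℝ k fun x => B M (p x) ν V :=
  ContDiff.sum fun s _ => contDiff_const.mul (contDiff_bellmanPolicy hp V s)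

lemma contDiff_B_occupancy (hp : ∀ s a, ContDiff ℝ k fun x => (p x).prob s a) (q : Policy M)
    (ξ V : State M → ℝ) : ContDiff ℝ k fun x => B M q (occupancy M ξ (p x)) V :=
  ContDiff.sum fun s _ => (contDiff_occupancy hp ξ s).mul contDiff_const

lemma policy_gradient {p : ℝ → Policy M}
    (hp : ∀ s a, ContDiff ℝ 1 fun x => (p x).prob s a) (ξ : State M → ℝ) (θ : ℝ) :
    (1 - M.disc) * deriv (fun x => J M ξ (p x)) θ =
      deriv (fun x => B M (p x) (occupancy M ξ (p θ)) (value M (p θ))) θ := by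
  set V := value M (p θ) with hV
  have hν (s : State M) := ((contDiff_occupancy hp ξ s).differentiable one_ne_zero θ).hasDerivAt
  have hT (s : State M) := ((contDiff_bellmanPolicy hp V s).differentiable one_ne_zero θ).hasDerivAt
  have hB : HasDerivAt (fun x => B M (p x) (occupancy M ξ (p θ)) V)
      (∑ s, occupancy M ξ (p θ) s * deriv (fun x => bellmanPolicy M (p x) V s) θ) θ :=
    HasDerivAt.fun_sum fun s _ => (hT s).const_mul _
  -- The derivative of the occupancy drops out because `V` is the fixed point of `T_{p θ}`.
  have hdiff : HasDerivAt
      (fun x => ∑ s, occupancy M ξ (p x) s * (bellmanPolicy M (p x) V s - V s))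
      (∑ s, occupancy M ξ (p θ) s * deriv (fun x => bellmanPolicy M (p x) V s) θ) θ := by
    refine (HasDerivAt.fun_sum fun s _ => (hν s).mul ((hT s).sub_const (V s))).congr_deriv ?_
    simp only [hV, bellmanPolicy_value, sub_self, mul_zero, zero_add]
  simp only [performance_difference] at hdiff
  have hJ := ((contDiff_J hp ξ).differentiable one_ne_zero θ).hasDerivAt
  rw [hB.deriv, ← hdiff.unique ((hJ.sub_const _).const_mul _)]

end Smoothness

section ApproximateOptimality

lemma exists_bellmanPolicy_eq_bellman (V : State M → ℝ) :
    ∃ p : Policy M, bellmanPolicy M p V = bellman M V := by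
  choose greedy hgreedy using fun s => exists_eq_ciInf_of_finite (f := fun a => qValue M V s a)
  refine ⟨⟨fun s a => if a = greedy s then 1 else 0, fun s a => by positivity, fun s => by simp⟩,
    funext fun s => ?_⟩
  simp only [bellmanPolicy, ite_mul, one_mul, zero_mul, Finset.sum_ite_eq', Finset.mem_univ,
    if_true]
  exact hgreedy s

lemma bellman_le_bellmanPolicy (p : Policy M) (V : State M → ℝ) (s : State M) :
    bellman M V s ≤ bellmanPolicy M p V s := by
  calc bellman M V s = ∑ a, p.prob s a * bellman M V s := by
        rw [← Finset.sum_mul, p.sum_one, one_mul]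
    _ ≤ bellmanPolicy M p V s := Finset.sum_le_sum fun a _ => mul_le_mul_of_nonneg_left
        (ciInf_le (Set.finite_range _).bddBelow a) (p.nonneg s a)

lemma bellman_value_le (p : Policy M) (s : State M) : bellman M (value M p) s ≤ value M p s :=
  (bellman_le_bellmanPolicy p _ s).trans_eq (congrFun (bellmanPolicy_value p) s)

instance : Nonempty (Policy M) := ⟨hard M 0⟩

lemma sum_mul_valueOpt_le_Jopt (hξ : ∀ s, 0 ≤ ξ s) : ∑ s, ξ s * valueOpt M s ≤ Jopt M ξ :=
  le_ciInf fun p => Finset.sum_le_sum fun s _ => mul_le_mul_of_nonneg_left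
    (ciInf_le ⟨0, Set.forall_mem_range.2 fun q => (value_mem_Icc q s).1⟩ p) (hξ s)

lemma J_sub_Jopt_le_norm1 (hξ : ∀ s, 0 ≤ ξ s) (p : Policy M) :
    J M ξ p - Jopt M ξ ≤ norm1 M ξ fun s => value M p s - valueOpt M s := by
  calc J M ξ p - Jopt M ξ
      ≤ J M ξ p - ∑ s, ξ s * valueOpt M s := sub_le_sub_left (sum_mul_valueOpt_le_Jopt hξ) _
    _ = ∑ s, ξ s * (value M p s - valueOpt M s) := by
        simp only [J, mul_sub, Finset.sum_sub_distrib]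
    _ ≤ norm1 M ξ fun s => value M p s - valueOpt M s :=
        Finset.sum_le_sum fun s _ => mul_le_mul_of_nonneg_left (le_abs_self _) (hξ s)

lemma norm1_value_sub_bellman_le (hξ : ∀ s, 0 ≤ ξ s) {p : Policy M} {ε : ℝ}
    (hp : ∀ q, B M p (occupancy M ξ p) (value M p) ≤ B M q (occupancy M ξ p) (value M p) + ε) :
    (1 - M.disc) * norm1 M ξ (fun s => value M p s - bellman M (value M p) s) ≤ ε := by
  obtain ⟨greedy, hgreedy⟩ := exists_bellmanPolicy_eq_bellman (value M p)
  calc (1 - M.disc) * norm1 M ξ (fun s => value M p s - bellman M (value M p) s)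
      = ∑ s, (1 - M.disc) * ξ s * (value M p s - bellman M (value M p) s) := by
        simp only [norm1, abs_of_nonneg (sub_nonneg.2 (bellman_value_le p _)), Finset.mul_sum,
          mul_assoc]
    _ ≤ ∑ s, occupancy M ξ p s * (value M p s - bellman M (value M p) s) :=
        Finset.sum_le_sum fun s _ => mul_le_mul_of_nonneg_right
          (one_sub_disc_mul_le_occupancy hξ p s) (sub_nonneg.2 (bellman_value_le p s))
    _ = B M p (occupancy M ξ p) (value M p) - B M greedy (occupancy M ξ p) (value M p) := by
        simp only [B, hgreedy, bellmanPolicy_value, mul_sub, Finset.sum_sub_distrib]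
    _ ≤ ε := sub_le_iff_le_add'.2 (hp greedy)

lemma one_sub_disc_mul_J_sub_Jopt_le (hξ : ∀ s, 0 ≤ ξ s) {p : Policy M} {κ ε : ℝ} (hκ : 0 ≤ κ)
    (hnorm : norm1 M ξ (fun s => value M p s - valueOpt M s) ≤
      κ / (1 - M.disc) * norm1 M ξ (fun s => value M p s - bellman M (value M p) s))
    (hp : ∀ q, B M p (occupancy M ξ p) (value M p) ≤ B M q (occupancy M ξ p) (value M p) + ε) :
    (1 - M.disc) * (J M ξ p - Jopt M ξ) ≤ κ / (1 - M.disc) * ε := by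
  have hγ : 0 < 1 - M.disc := one_sub_disc_pos
  calc (1 - M.disc) * (J M ξ p - Jopt M ξ)
      ≤ (1 - M.disc) * (κ / (1 - M.disc) *
          norm1 M ξ (fun s => value M p s - bellman M (value M p) s)) :=
        mul_le_mul_of_nonneg_left ((J_sub_Jopt_le_norm1 hξ p).trans hnorm) hγ.le
    _ = κ / (1 - M.disc) *
          ((1 - M.disc) * norm1 M ξ (fun s => value M p s - bellman M (value M p) s)) :=
        mul_left_comm _ _ _
    _ ≤ κ / (1 - M.disc) * ε :=
        mul_le_mul_of_nonneg_left (norm1_value_sub_bellman_le hξ hp) (div_nonneg hκ hγ.le)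

end ApproximateOptimality

section Threshold

variable {σ θ x ε : ℝ} {ν V : State M → ℝ} {r r' : ℕ → ℝ}

variable (M) in
/-- The advantage of routing to server 2 over waiting when server 1 is busy, server 2 is idle and
`l` jobs wait, weighted by `ν`. A fast-first policy enters the policy improvement objective only
through these numbers. -/
def routingAdvantage (ν V : State M → ℝ) (l : Fin (M.cap + 1)) : ℝ :=
  ν (l, true, false) * (qValue M V (l, true, false) 2 - qValue M V (l, true, false) 0)

lemma routingAdvantage_eq_zero_of_empty {l : Fin (M.cap + 1)} (hl : (l : ℕ) = 0) :
    routingAdvantage M ν V l = 0 := by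
  simp [routingAdvantage, qValue, trans, dispatch, hl]

lemma bellmanPolicy_fastFirst_sub (hr : ∀ l, 0 ≤ r l ∧ r l ≤ 1) (hr' : ∀ l, 0 ≤ r' l ∧ r' l ≤ 1)
    (V : State M → ℝ) (s : State M) :
    bellmanPolicy M (fastFirst M r hr) V s - bellmanPolicy M (fastFirst M r' hr') V s =
      if s.2 = (true, false) then (qValue M V s 2 - qValue M V s 0) * (r s.1 - r' s.1) else 0 := by
  obtain ⟨l, b₁, b₂⟩ := s
  cases b₁ <;> cases b₂ <;> simp [bellmanPolicy, fastFirst, Fin.sum_univ_three]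
  ring

lemma B_fastFirst_sub (hr : ∀ l, 0 ≤ r l ∧ r l ≤ 1) (hr' : ∀ l, 0 ≤ r' l ∧ r' l ≤ 1)
    (ν V : State M → ℝ) :
    B M (fastFirst M r hr) ν V - B M (fastFirst M r' hr') ν V =
      ∑ l, routingAdvantage M ν V l * (r l - r' l) := by
  simp only [B, ← Finset.sum_sub_distrib, ← mul_sub, bellmanPolicy_fastFirst_sub]
  simp [Fintype.sum_prod_type, routingAdvantage, mul_assoc]

lemma B_fastFirst_le_add {a b δ : ℝ} (hr : ∀ l, 0 ≤ r l ∧ r l ≤ 1)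
    (hr' : ∀ l, 0 ≤ r' l ∧ r' l ≤ 1) (hν : ν ∈ stdSimplex ℝ (State M))
    (hV : ∀ s i, qValue M V s i ∈ Set.Icc a b) (hδ : ∀ l, |r l - r' l| ≤ δ) :
    B M (fastFirst M r hr) ν V ≤ B M (fastFirst M r' hr') ν V + (b - a) * δ := by
  have hstate (s : State M) :
      bellmanPolicy M (fastFirst M r hr) V s - bellmanPolicy M (fastFirst M r' hr') V s ∈
        Set.Icc (-((b - a) * δ)) ((b - a) * δ) := by
    have hQ := Real.dist_le_of_mem_Icc (hV s 2) (hV s 0)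
    rw [Real.dist_eq] at hQ
    rw [bellmanPolicy_fastFirst_sub, Set.mem_Icc, ← abs_le]
    split_ifs
    · rw [abs_mul]
      exact mul_le_mul hQ (hδ _) (abs_nonneg _) ((abs_nonneg _).trans hQ)
    · rw [abs_zero]
      exact mul_nonneg ((abs_nonneg _).trans hQ) ((abs_nonneg _).trans (hδ 0))
  have hmean := (sum_mul_mem_Icc_of_mem_stdSimplex hν hstate).2
  simp only [mul_sub, Finset.sum_sub_distrib] at hmean
  exact sub_le_iff_le_add'.1 hmean

lemma soft_eq_fastFirst_sigmoid (σ x : ℝ) :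
    soft M σ x = fastFirst M (fun l => Real.sigmoid (σ * (l - x)))
      fun _ => ⟨Real.sigmoid_nonneg _, Real.sigmoid_le_one _⟩ := by
  simp only [soft, exp_div_one_add_exp]

lemma contDiff_soft_prob (k : WithTop ℕ∞) (σ : ℝ) (s : State M) (a : Action) :
    ContDiff ℝ k fun x => (soft M σ x).prob s a := by
  have hsigmoid : ContDiff ℝ k fun x => Real.sigmoid (σ * ((s.1 : ℕ) - x)) :=
    (contDiff_sigmoid.of_le le_top).comp (by fun_prop)
  simp only [soft_eq_fastFirst_sigmoid, fastFirst]
  split_ifs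
  any_goals exact contDiff_const
  · exact hsigmoid
  · exact contDiff_const.sub hsigmoid

lemma B_soft_eq_sigmoidMixture_add (σ x : ℝ) (ν V : State M → ℝ) :
    B M (soft M σ x) ν V = sigmoidMixture σ (routingAdvantage M ν V) (fun l => (l : ℕ)) x +
      B M (fastFirst M (fun _ => 0) fun _ => ⟨le_rfl, zero_le_one⟩) ν V := by
  rw [← sub_eq_iff_eq_add, soft_eq_fastFirst_sigmoid, B_fastFirst_sub]
  simp only [sub_zero, sigmoidMixture]

lemma noSuboptimalStationary_of_singleCrossing (hσ : 0 ≤ σ) (hξ : ∀ s, 0 ≤ ξ s)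
    (hcross : SingleCrossing M σ θ) : NoSuboptimalStationary M σ ξ θ := by
  obtain ⟨n, hn⟩ := hcross
  intro x hx y
  simp only [piObjective, B_soft_eq_sigmoidMixture_add, deriv_add_const] at hx ⊢
  refine add_le_add_left (sigmoidMixture_le_of_deriv_eq_zero (c := n) hσ ?_ ?_ hx y) _
  · intro l hl
    rcases Nat.eq_zero_or_pos (l : ℕ) with hempty | hpos
    · rw [routingAdvantage_eq_zero_of_empty hempty]
    · exact mul_nonneg (occupancy_nonneg hξ _ _)
        (sub_nonneg.2 ((hn l hpos).1 (Nat.cast_le.1 hl)))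
  · intro l hl
    have hnl : n < (l : ℕ) := Nat.cast_lt.1 hl
    exact mul_nonpos_of_nonneg_of_nonpos (occupancy_nonneg hξ _ _)
      (sub_nonpos.2 ((hn l (Nat.one_le_of_lt hnl)).2 hnl))

lemma closedUpTo_of_forall_le_add (hξ : ξ ∈ stdSimplex ℝ (State M))
    (hx : ∀ p, piObjective M σ ξ θ (soft M σ x) ≤ piObjective M σ ξ θ p + ε) :
    ClosedUpTo M σ ξ θ ε := by
  have hbdd : BddBelow (Set.range fun y => piObjective M σ ξ θ (soft M σ y)) :=
    ⟨0, Set.forall_mem_range.2 fun y => (piObjective_mem_Icc hξ σ θ _).1⟩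
  exact (ciInf_le hbdd x).trans <| sub_le_iff_le_add.1 <| le_ciInf fun p =>
    sub_le_iff_le_add.2 (hx p)

lemma piObjective_le_add_of_closedUpTo (hξ : ξ ∈ stdSimplex ℝ (State M))
    (hx : ∀ y, piObjective M σ ξ θ (soft M σ x) ≤ piObjective M σ ξ θ (soft M σ y))
    (hε : ClosedUpTo M σ ξ θ ε) (p : Policy M) :
    piObjective M σ ξ θ (soft M σ x) ≤ piObjective M σ ξ θ p + ε := by
  have hbdd : BddBelow (Set.range (piObjective M σ ξ θ)) :=
    ⟨0, Set.forall_mem_range.2 fun q => (piObjective_mem_Icc hξ σ θ q).1⟩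
  exact (le_ciInf hx).trans (hε.trans (by gcongr; exact ciInf_le hbdd p))

lemma closedUpTo_valueBound (hξ : ξ ∈ stdSimplex ℝ (State M)) (σ θ : ℝ) :
    ClosedUpTo M σ ξ θ (valueBound M) :=
  closedUpTo_of_forall_le_add (x := 0) hξ fun p =>
    (piObjective_mem_Icc hξ σ θ _).2.trans
      (le_add_of_nonneg_left (piObjective_mem_Icc hξ σ θ p).1)

lemma abs_sigmoid_sub_ite_lt_le (hσ : 0 < σ) (n l : ℕ) :
    |Real.sigmoid (σ * (l - (n + 1 / 2))) - if n < l then 1 else 0| ≤ Real.exp (-(σ / 2)) := by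
  have hsign : n < l ↔ 0 < σ * (l - (n + 1 / 2) : ℝ) := by
    rw [mul_pos_iff_of_pos_left hσ, sub_pos]
    refine ⟨fun h => ?_, fun h => ?_⟩
    · have : (n + 1 : ℝ) ≤ l := by exact_mod_cast h
      linarith
    · exact_mod_cast (by linarith : (n : ℝ) < l)
  have hhalf : 1 / 2 ≤ |(l - (n + 1 / 2) : ℝ)| := by
    rcases Nat.lt_or_ge n l with h | h
    · have : (n + 1 : ℝ) ≤ l := by exact_mod_cast h
      exact le_abs.2 (Or.inl (by linarith))
    · have : (l : ℝ) ≤ n := by exact_mod_cast h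
      exact le_abs.2 (Or.inr (by linarith))
  have hdist : σ / 2 ≤ |σ * (l - (n + 1 / 2) : ℝ)| := by
    rw [abs_mul, abs_of_pos hσ]
    linarith [mul_le_mul_of_nonneg_left hhalf hσ.le]
  simp only [hsign]
  exact (abs_sigmoid_sub_ite_le _).trans (Real.exp_le_exp.2 (neg_le_neg hdist))

lemma closedUpTo_of_thresholdImproves (hσ : 0 < σ) (hξ : ξ ∈ stdSimplex ℝ (State M))
    (hthreshold : ThresholdImproves M σ ξ θ) :
    ClosedUpTo M σ ξ θ (valueBound M * Real.exp (-(σ / 2))) := by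
  obtain ⟨n, hn⟩ := hthreshold
  have hsoft : piObjective M σ ξ θ (soft M σ (n + 1 / 2)) ≤
      piObjective M σ ξ θ (hard M n) + valueBound M * Real.exp (-(σ / 2)) := by
    rw [soft_eq_fastFirst_sigmoid, ← sub_zero (valueBound M)]
    exact B_fastFirst_le_add _ _ (occupancy_mem_stdSimplex hξ _) (qValue_mem_Icc (value_mem_Icc _))
      (abs_sigmoid_sub_ite_lt_le hσ n)
  exact closedUpTo_of_forall_le_add hξ fun p => hsoft.trans (by gcongr; exact hn p)

end Threshold

end TwoServer

end

theorem theorem2 (M : TwoServer.Queue) (ξ : TwoServer.State M → ℝ)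
    (hξ : ξ ∈ stdSimplex ℝ (TwoServer.State M)) :
    -- the statements about a fixed sharpness `σ`
    (∀ σ : ℝ, 0 < σ →
      -- `J_γ` is continuously differentiable
      ContDiff ℝ 1 (fun θ : ℝ => TwoServer.J M ξ (TwoServer.soft M σ θ)) ∧
      -- differentiability of the weighted policy iteration objective in both parameters
      (∀ θ : ℝ,
        ContDiff ℝ 1 (fun x : ℝ => TwoServer.B M (TwoServer.soft M σ x)
          (TwoServer.occupancy M ξ (TwoServer.soft M σ θ))
          (TwoServer.value M (TwoServer.soft M σ θ))) ∧
        ContDiff ℝ 1 (fun x : ℝ => TwoServer.B M (TwoServer.soft M σ θ)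
          (TwoServer.occupancy M ξ (TwoServer.soft M σ x))
          (TwoServer.value M (TwoServer.soft M σ θ)))) ∧
      -- closure under approximate policy improvement, with a finite error
      (∃ ε : ℝ, 0 ≤ ε ∧ ∀ θ : ℝ, TwoServer.ClosedUpTo M σ ξ θ ε) ∧
      -- single crossing excludes sub-optimal stationary points
      (∀ θ : ℝ, TwoServer.SingleCrossing M σ θ → TwoServer.NoSuboptimalStationary M σ ξ θ) ∧
      -- approximate optimality of the stationary points of `J_γ`
      (∀ κ : ℝ, TwoServer.IsConcentrability M σ ξ κ →
        ∀ θ : ℝ, TwoServer.NoSuboptimalStationary M σ ξ θ →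
          deriv (fun x : ℝ => TwoServer.J M ξ (TwoServer.soft M σ x)) θ = 0 →
          ∀ ε : ℝ, 0 ≤ ε → TwoServer.ClosedUpTo M σ ξ θ ε →
            (1 - M.disc) * (TwoServer.J M ξ (TwoServer.soft M σ θ) - TwoServer.Jopt M ξ) ≤
              κ / (1 - M.disc) * ε)) ∧
    -- the error tends to `0` as the sharpness grows, where policy improvement is of threshold type
    (∃ ε : ℝ → ℝ, Tendsto ε atTop (𝓝 0) ∧ ∀ σ : ℝ, 0 < σ → 0 ≤ ε σ ∧
      ∀ θ : ℝ, TwoServer.ThresholdImproves M σ ξ θ → TwoServer.ClosedUpTo M σ ξ θ (ε σ)) := by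
  have hsoft (σ : ℝ) := TwoServer.contDiff_soft_prob (M := M) 1 σ
  have hbound := TwoServer.valueBound_nonneg M
  refine ⟨fun σ hσ => ⟨TwoServer.contDiff_J (hsoft σ) ξ, fun θ =>
    ⟨TwoServer.contDiff_B (hsoft σ) _ _, TwoServer.contDiff_B_occupancy (hsoft σ) _ _ _⟩,
    ⟨TwoServer.valueBound M, hbound, TwoServer.closedUpTo_valueBound hξ σ⟩,
    fun θ => TwoServer.noSuboptimalStationary_of_singleCrossing hσ.le hξ.1, ?_⟩,
    fun σ => TwoServer.valueBound M * Real.exp (-(σ / 2)), ?_, fun σ hσ =>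
      ⟨by positivity, fun θ => TwoServer.closedUpTo_of_thresholdImproves hσ hξ⟩⟩
  · intro κ hκ θ hθ hJ ε _ hε
    have hstationary :
        deriv (fun x => TwoServer.piObjective M σ ξ θ (TwoServer.soft M σ x)) θ = 0 :=
      (TwoServer.policy_gradient (hsoft σ) ξ θ).symm.trans (by rw [hJ, mul_zero])
    exact TwoServer.one_sub_disc_mul_J_sub_Jopt_le hξ.1 hκ.1.1 (hκ.1.2 θ)
      (TwoServer.piObjective_le_add_of_closedUpTo hξ (hθ θ hstationary) hε)
  · have hexp : Tendsto (fun σ : ℝ => Real.exp (-(σ / 2))) atTop (𝓝 0) :=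
      Real.tendsto_exp_neg_atTop_nhds_zero.comp (tendsto_id.atTop_div_const two_pos)
    simpa only [mul_zero] using hexp.const_mul (TwoServer.valueBound M)
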